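/- Let $E=\{1,\dots,K\}$, let $P=(p_{kj})$ be an irreducible stochastic matrix on $E$ with stationary distribution $\pi$, and let $\Pi=\mathrm{diag}(\pi)$. Let $\Gamma_0$ be the Palm version of the semi-Markov environment with routing matrix $P$ and positive sojourn times $T_k$, i.e. the two-sided semi-Markov process with a transition at time $0$ whose embedded chain is stationary with law $\pi$ (given the successive states, the sojourn times are independent, those in state $k$ being distributed as $T_k$). Let $\tau_k(s)=\mathbb E[e^{-sT_k}]$. In state $k$ customers arrive at rate $\lambda_k\ge 0$ and the servers work at speed $\beta_k\ge 0$; service requests are exponential with rate $\mu>0$, with distribution function $G(\sigma)=1-e^{-\mu\sigma}$. Assume $\max_k\beta_k>0$ and put $\mu_k=\mu\beta_k$. Let $$F(u)=\int_u^0\beta_{\Gamma_0(t)}\,dt,\qquad A=\{(u,\sigma): u<0,\ \sigma>0,\ \sigma>F(u)\},\qquad |A|=\int_A \lambda_{\Gamma_0(u)}\,du\,G(d\sigma),$$ and, for $n\ge 0$, let $\vec m_0^{\dagger(n)}$ be the row vector with entries $m_{0k}^{(n)}=\mathbb E\big[|A|^n \,\big|\, \Gamma_0(0^-)=k\big]$,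 $k\in E$. For $n\ge0$ put $$B'_n=\mathrm{diag}\!\left(\frac1{\tau_k(n\mu_k)}\right)-P .$$ (i) For every integer $n>0$ the matrix $B'_n$ is nonsingular. (ii) Assume that $\lambda_k=0$ for every $k$ with $\mu_k=0$ (in particular, this holds if all $\mu_k>0$), and let $R=\mathrm{diag}(\rho_k)$ with $\rho_k=\lambda_k/\mu_k$ (and $\rho_k=0$ if $\lambda_k=\mu_k=0$). Then $|A|<\infty$ almost surely, all the moments $m_{0k}^{(n)}$ are finite, and for every integer $n\ge0$ $$\sum_{j=0}^n(-1)^j\binom nj\,\vec m_0^{\dagger(j)}\,\Pi\,B'_n\,R^{\,n-j}=0 .$$ -/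

import Mathlib

open MeasureTheory ProbabilityTheory
open scoped Matrix ENNReal

namespace MMInfty

noncomputable section

/-- `π` is a stationary probability vector of the transition matrix `P`. -/
structure IsStationaryLaw {K : ℕ} (P : Matrix (Fin K) (Fin K) ℝ) (π : Fin K → ℝ) : Prop where
  nonneg : ∀ k, 0 ≤ π k
  sum_eq_one : ∑ k, π k = 1
  invariant : π ᵥ* P = π

/-- Transition epochs built from the sojourn times `s n`: the epoch number `0` is the time `0`, and
`epoch s (n + 1) = epoch s n + s n` for every integer `n` (see `epoch_succ`). -/
def epoch (s : ℤ → ℝ) (n : ℤ) : ℝ :=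
  ∑ i ∈ Finset.Ico 0 n, s i - ∑ i ∈ Finset.Ico n 0, s i

theorem epoch_zero (s : ℤ → ℝ) : epoch s 0 = 0 := by simp [epoch]

theorem epoch_succ (s : ℤ → ℝ) (n : ℤ) : epoch s (n + 1) = epoch s n + s n := by
  unfold epoch
  rcases le_or_gt 0 n with h | h
  · have h1 : Finset.Ico (0 : ℤ) (n + 1) = insert n (Finset.Ico 0 n) := by
      ext i; simp only [Finset.mem_insert, Finset.mem_Ico]; omega
    rw [h1, Finset.sum_insert (by simp), Finset.Ico_eq_empty (by omega : ¬ n + 1 < 0),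
      Finset.Ico_eq_empty (by omega : ¬ n < 0)]
    simp [add_comm]
  · have h1 : Finset.Ico n (0 : ℤ) = insert n (Finset.Ico (n + 1) 0) := by
      ext i; simp only [Finset.mem_insert, Finset.mem_Ico]; omega
    rw [h1, Finset.sum_insert (by simp), Finset.Ico_eq_empty (by omega : ¬ 0 < n + 1),
      Finset.Ico_eq_empty (by omega : ¬ 0 < n)]
    simp

/-- The path of the environment: at time `u` it is in the state entered at the last transition
epoch not later than `u`; that is, it is in state `x n` on `[epoch s n, epoch s (n + 1))`. -/
def envPath {K : ℕ} (x : ℤ → Fin K) (s : ℤ → ℝ) (u : ℝ) : Fin K :=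
  x (sSup {n : ℤ | epoch s n ≤ u})

theorem envPath_eq {K : ℕ} (x : ℤ → Fin K) (s : ℤ → ℝ) (hs : ∀ n, 0 < s n) (n : ℤ) (u : ℝ)
    (h1 : epoch s n ≤ u) (h2 : u < epoch s (n + 1)) : envPath x s u = x n := by
  have hmono : Monotone (epoch s) :=
    monotone_int_of_le_succ fun m => by rw [epoch_succ]; linarith [hs m]
  have hg : IsGreatest {m : ℤ | epoch s m ≤ u} n := by
    refine ⟨h1, fun m hm => ?_⟩
    by_contra hlt
    have := hmono (by omega : n + 1 ≤ m)
    have hm' : epoch s m ≤ u := hm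
    linarith
  rw [envPath, hg.csSup_eq]

/-- `(X n, S n)`, `n ∈ ℤ`, are the successive states and sojourn times of the semi-Markov
environment with routing matrix `P` and sojourn time laws `ν k`, in its Palm version: a transition
takes place at time `0`, which starts the sojourn number `0`, and the embedded chain is stationary
with law `π`. Given the states, the sojourn times are independent, `S n` having law `ν (X n)`. -/
structure IsPalmEnvironment {K : ℕ} (P : Matrix (Fin K) (Fin K) ℝ) (π : Fin K → ℝ)
    (ν : Fin K → Measure ℝ) {Ω : Type*} [MeasurableSpace Ω] (Pr : Measure Ω)
    (X : ℤ → Ω → Fin K) (S : ℤ → Ω → ℝ) : Prop where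
  measurable_state : ∀ n, Measurable (X n)
  measurable_sojourn : ∀ n, Measurable (S n)
  law : ∀ (m : ℤ) (n : ℕ) (x : ℕ → Fin K) (B : ℕ → Set ℝ), (∀ i, MeasurableSet (B i)) →
    Pr {ω | ∀ i ∈ Finset.range (n + 1), X (m + i) ω = x i ∧ S (m + i) ω ∈ B i} =
      ENNReal.ofReal (π (x 0) * ∏ i ∈ Finset.range n, P (x i) (x (i + 1))) *
        ∏ i ∈ Finset.range (n + 1), ν (x i) (B i)

/-- `F_γ(u) = ∫_u^0 β_{γ(t)} dt`, the work done by a busy server during `[u, 0)`. -/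
def work {K : ℕ} (β : Fin K → ℝ) (γ : ℝ → Fin K) (u : ℝ) : ℝ := ∫ t in u..0, β (γ t)

/-- The set `A_γ` of the pairs (arrival time, service time) of the customers that arrive before
time `0` and are still in the system at time `0`. -/
def presentSet {K : ℕ} (β : Fin K → ℝ) (γ : ℝ → Fin K) : Set (ℝ × ℝ) :=
  {p | p.1 < 0 ∧ 0 < p.2 ∧ work β γ p.1 < p.2}

/-- The measure `λ_γ(du, dσ) = λ_{γ(u)} du G(dσ)`, with `G` the exponential law of rate `μ`. -/
def intensity {K : ℕ} (lam : Fin K → ℝ) (μ : ℝ) (γ : ℝ → Fin K) : Measure (ℝ × ℝ) :=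
  (volume.withDensity fun u => ENNReal.ofReal (lam (γ u))).prod (expMeasure μ)

/-- The random variable `λ_{Γ₀}(A_{Γ₀})` for the environment with states `X` and sojourns `S`. -/
def presentMeasure {K : ℕ} (lam β : Fin K → ℝ) (μ : ℝ) {Ω : Type*}
    (X : ℤ → Ω → Fin K) (S : ℤ → Ω → ℝ) (ω : Ω) : ℝ≥0∞ :=
  intensity lam μ (envPath (fun n => X n ω) fun n => S n ω)
    (presentSet β (envPath (fun n => X n ω) fun n => S n ω))

/-- The conditional probability given `Γ₀(0⁻) = k`, i.e. given that the sojourn that ends at time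
`0` is spent in state `k`. -/
def lastStateCond {K : ℕ} {Ω : Type*} [MeasurableSpace Ω] (Pr : Measure Ω)
    (X : ℤ → Ω → Fin K) (k : Fin K) : Measure Ω :=
  ProbabilityTheory.cond Pr {ω | X (-1) ω = k}

/-- The row vector of the moments of order `n` of `|A_{0k}|`. -/
def momentVec {K : ℕ} (lam β : Fin K → ℝ) (μ : ℝ) {Ω : Type*} [MeasurableSpace Ω]
    (Pr : Measure Ω) (X : ℤ → Ω → Fin K) (S : ℤ → Ω → ℝ) (n : ℕ) : Fin K → ℝ :=
  fun k => ∫ ω, (presentMeasure lam β μ X S ω).toReal ^ n ∂(lastStateCond Pr X k)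

/-- The Laplace transform `s ↦ E[exp (-s T)]` of a random variable `T` of law `ν`. -/
def laplaceTransform (ν : Measure ℝ) (s : ℝ) : ℝ := ∫ t, Real.exp (-(s * t)) ∂ν

/-- `R = diag (λ_k / μ_k)` with `μ_k = μ β_k`. -/
def matR {K : ℕ} (lam β : Fin K → ℝ) (μ : ℝ) : Matrix (Fin K) (Fin K) ℝ :=
  Matrix.diagonal fun k => lam k / (μ * β k)

/-- `B'_n = diag (1 / τ_k(n μ_k)) - P` with `μ_k = μ β_k`. -/
def matB' {K : ℕ} (P : Matrix (Fin K) (Fin K) ℝ) (ν : Fin K → Measure ℝ) (β : Fin K → ℝ) (μ : ℝ)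
    (n : ℕ) : Matrix (Fin K) (Fin K) ℝ :=
  Matrix.diagonal (fun k => (laplaceTransform (ν k) (n * (μ * β k)))⁻¹) - P

end

end MMInfty

/-! For (ii), look back from time 0 over the last sojourn, spent in state `l` for a time `S`.
Customers who arrived during it contribute `ρ_l (1 - e^{-μ_l S})`, and what was present at its start
is thinned by `e^{-μ_l S}`. So `|A| = ρ_l (1 - e^{-μ_l S}) + e^{-μ_l S} |A|'`, that is, `ρ_l - |A| =
e^{-μ_l S} (ρ_l - |A|')`, where `|A|'` is the same functional of the past before that sojourn. In
the Palm version the past has the same law at every transition, and given the last state, `S` is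
independent of the earlier past. Taking `n`-th powers and integrating over `{X (-1) = l}`, `E[(ρ_l -
|A|)^n; X (-1) = l] = τ_l(n μ_l) ∑_k P k l E[(ρ_l - |A|)^n; X (-1) = k]`. Dividing by `τ_l(n μ_l)`
and expanding the powers gives column `l` of the claimed identity.

The recursion writes `|A|` as a convex combination of `ρ_l` and `|A|'`, so `|A|` is bounded by the
largest `ρ_k`; this gives finiteness and all moments. Rigorously, everything is done for the sum of
the contributions of the last `N` sojourns (`sum_contribution_succ`, `sum_contribution_le`,
`setIntegral_pow_sum_succ`) and passed to the limit by dominated convergence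
(`setIntegral_pow_presentMeasure`). That the sojourns exhaust the negative half-line is
`ae_tsum_sojourn`.

For (i), `1 / τ_k(n μ_k) ≥ 1`, strictly where `μ_k > 0`, and a maximum principle along paths of the
irreducible `P` excludes a kernel (`isUnit_diagonal_sub`). -/

namespace MMInfty

/-! ### Law of the past: stationarity and the Markov property -/

/-- Finite measures on a space of sequences agree if they agree on boxes. -/
theorem ext_of_boxes {α : Type*} [MeasurableSpace α] {μ₁ μ₂ : Measure (ℕ → α)}
    [IsFiniteMeasure μ₁]
    (h : ∀ (n : ℕ) (t : ℕ → Set α), (∀ i, MeasurableSet (t i)) →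
      μ₁ {y | ∀ i ∈ Finset.range (n + 1), y i ∈ t i} =
        μ₂ {y | ∀ i ∈ Finset.range (n + 1), y i ∈ t i}) : μ₁ = μ₂ := by
  classical
  refine ext_of_generate_finite _ generateFrom_squareCylinders.symm
    (isPiSystem_squareCylinders (fun _ => MeasurableSpace.isPiSystem_measurableSet) (by simp)) ?_ ?_
  · rintro _ ⟨s, t, ht, rfl⟩
    have ht' : ∀ i, MeasurableSet (t i) := fun i => ht i (Set.mem_univ i)
    -- A cylinder over any finite index set is a box over an initial segment, with full sides at the
    -- missing indices.
    have key : (s : Set ℕ).pi t = {y | ∀ i ∈ Finset.range (s.sup id + 1),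
        y i ∈ if i ∈ s then t i else Set.univ} := by
      ext y
      constructor
      · intro hy i _
        by_cases hi : i ∈ s
        · simpa [hi] using hy i hi
        · simp [hi]
      · intro hy i hi
        have hi' : i ∈ s := hi
        have h1 : i ≤ s.sup id := Finset.le_sup (f := id) hi'
        have := hy i (Finset.mem_range.2 (by omega))
        simpa [hi'] using this
    rw [key]
    refine h _ _ fun i => ?_
    by_cases hi : i ∈ s
    · simpa [hi] using ht' i
    · simp [hi]
  · have := h 0 (fun _ => Set.univ) (fun _ => MeasurableSet.univ)
    simpa using this

theorem measure_eq_sum_inter_preimage {Ω ι : Type*} [MeasurableSpace Ω] [Fintype ι]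
    [MeasurableSpace ι] [MeasurableSingletonClass ι] (Pr : Measure Ω) {Y : Ω → ι}
    (hY : Measurable Y) (A : Set Ω) :
    Pr A = ∑ y, Pr (A ∩ Y ⁻¹' {y}) := by
  have h := sum_measure_preimage_singleton (μ := Pr.restrict A) Finset.univ (f := Y)
    (fun y _ => hY (measurableSet_singleton y))
  simp only [Finset.coe_univ, Set.preimage_univ, Measure.restrict_apply_univ] at h
  rw [← h]
  refine Finset.sum_congr rfl fun y _ => ?_
  rw [Measure.restrict_apply (hY (measurableSet_singleton y)), Set.inter_comm]

variable {K : ℕ} {P : Matrix (Fin K) (Fin K) ℝ} {π : Fin K → ℝ} {ν : Fin K → Measure ℝ}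
  {Ω : Type*} {X : ℤ → Ω → Fin K} {S : ℤ → Ω → ℝ}

/-- The states and sojourn times before the transition number `m`, the latest first. -/
def past (X : ℤ → Ω → Fin K) (S : ℤ → Ω → ℝ) (m : ℤ) (ω : Ω) : ℕ → Fin K × ℝ :=
  fun j => (X (m - 1 - j) ω, S (m - 1 - j) ω)

/-- `law` prescribes the states exactly. Slicing a box of pairs by the state vector leaves sections
in the sojourn variables, which are events of that form. -/
theorem box_inter_preimage_stateVec (m : ℤ) (n : ℕ) (t : ℕ → Set (Fin K × ℝ)) (x : ℕ → Fin K) :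
    {ω | ∀ i ∈ Finset.range (n + 1), (X (m + i) ω, S (m + i) ω) ∈ t i} ∩
      (fun ω => fun i : Fin (n + 1) => X (m + (i : ℕ)) ω) ⁻¹' {fun i : Fin (n + 1) => x i} =
    {ω | ∀ i ∈ Finset.range (n + 1), X (m + i) ω = x i ∧ S (m + i) ω ∈ Prod.mk (x i) ⁻¹' t i} := by
  ext ω
  constructor
  · rintro ⟨h1, h2⟩ i hi
    have h3 : X (m + i) ω = x i := congrFun h2 ⟨i, Finset.mem_range.1 hi⟩
    refine ⟨h3, ?_⟩
    have := h1 i hi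
    rwa [h3] at this
  · intro h
    refine ⟨fun i hi => ?_, funext fun i => (h i (Finset.mem_range.2 i.2)).1⟩
    obtain ⟨h1, h2⟩ := h i hi
    rw [h1]; exact h2

/-- `past` runs backwards while `law` runs forwards; the reversal `i ↦ n - i` translates between
them. -/
theorem preimage_past_box (m : ℤ) (n : ℕ) (t : ℕ → Set (Fin K × ℝ)) :
    past X S m ⁻¹' {y | ∀ i ∈ Finset.range (n + 1), y i ∈ t i} =
      {ω | ∀ i ∈ Finset.range (n + 1),
        (X (m - 1 - n + i) ω, S (m - 1 - n + i) ω) ∈ t (n - i)} := by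
  ext ω
  constructor
  · intro h i hi
    have hi' := Finset.mem_range.1 hi
    have := h (n - i) (Finset.mem_range.2 (by omega))
    have e : m - 1 - ((n - i : ℕ) : ℤ) = m - 1 - n + i := by omega
    simpa [past, e] using this
  · intro h i hi
    have hi' := Finset.mem_range.1 hi
    have := h (n - i) (Finset.mem_range.2 (by omega))
    have e : m - 1 - n + ((n - i : ℕ) : ℤ) = m - 1 - i := by omega
    have e' : n - (n - i) = i := by omega
    simpa only [past, e, e'] using this

variable [MeasurableSpace Ω] {Pr : Measure Ω}

theorem IsPalmEnvironment.measurable_past (henv : IsPalmEnvironment P π ν Pr X S) (m : ℤ) :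
    Measurable (past X S m) :=
  measurable_pi_lambda _ fun j =>
    (henv.measurable_state (m - 1 - j)).prodMk (henv.measurable_sojourn (m - 1 - j))

theorem IsPalmEnvironment.measurable_stateVec (henv : IsPalmEnvironment P π ν Pr X S) (m : ℤ)
    (n : ℕ) : Measurable fun ω => fun i : Fin (n + 1) => X (m + (i : ℕ)) ω :=
  measurable_pi_lambda _ fun _ => henv.measurable_state _

theorem exists_extension (n : ℕ) (x : Fin (n + 1) → Fin K) :
    ∃ x' : ℕ → Fin K, x = fun i : Fin (n + 1) => x' i :=
  ⟨fun i => x (Fin.ofNat (n + 1) i), by funext i; simp⟩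

/-- After slicing by states, each term is given by `law`, whose right-hand side does not involve the
starting index. -/
theorem IsPalmEnvironment.box_shift (henv : IsPalmEnvironment P π ν Pr X S) (m m' : ℤ) (n : ℕ)
    {t : ℕ → Set (Fin K × ℝ)} (ht : ∀ i, MeasurableSet (t i)) :
    Pr {ω | ∀ i ∈ Finset.range (n + 1), (X (m + i) ω, S (m + i) ω) ∈ t i} =
      Pr {ω | ∀ i ∈ Finset.range (n + 1), (X (m' + i) ω, S (m' + i) ω) ∈ t i} := by
  rw [measure_eq_sum_inter_preimage Pr (henv.measurable_stateVec m n),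
    measure_eq_sum_inter_preimage Pr (henv.measurable_stateVec m' n)]
  refine Finset.sum_congr rfl fun x _ => ?_
  obtain ⟨x, rfl⟩ := exists_extension n x
  have hm : ∀ i, MeasurableSet (Prod.mk (x i) ⁻¹' t i) := fun i => measurable_prodMk_left (ht i)
  rw [box_inter_preimage_stateVec, box_inter_preimage_stateVec,
    henv.law m n x _ hm, henv.law m' n x _ hm]

/-- On each slice with final state `k`, appending one sojourn adds exactly the factors `P k l` and
`ν l B` to the product in `law`; the other slices are empty on both sides. -/
theorem IsPalmEnvironment.box_succ (henv : IsPalmEnvironment P π ν Pr X S)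
    (hP : ∀ i j, 0 ≤ P i j) (m : ℤ) (n : ℕ) {t : ℕ → Set (Fin K × ℝ)}
    (ht : ∀ i, MeasurableSet (t i)) (k l : Fin K) {B : Set ℝ} (hB : MeasurableSet B) :
    Pr ({ω | ∀ i ∈ Finset.range (n + 1), (X (m + i) ω, S (m + i) ω) ∈ t i} ∩
        ({ω | X (m + n) ω = k} ∩ {ω | X (m + n + 1) ω = l ∧ S (m + n + 1) ω ∈ B})) =
      Pr ({ω | ∀ i ∈ Finset.range (n + 1), (X (m + i) ω, S (m + i) ω) ∈ t i} ∩
        {ω | X (m + n) ω = k}) * (ENNReal.ofReal (P k l) * ν l B) := by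
  rw [measure_eq_sum_inter_preimage Pr (henv.measurable_stateVec m n),
    measure_eq_sum_inter_preimage Pr (henv.measurable_stateVec m n), Finset.sum_mul]
  refine Finset.sum_congr rfl fun x _ => ?_
  obtain ⟨x, rfl⟩ := exists_extension n x
  have hm : ∀ i, MeasurableSet (Prod.mk (x i) ⁻¹' t i) := fun i => measurable_prodMk_left (ht i)
  rw [Set.inter_right_comm, Set.inter_right_comm _ {ω | X (m + n) ω = k},
    box_inter_preimage_stateVec]
  by_cases hx : x n = k
  · have h1 : {ω | ∀ i ∈ Finset.range (n + 1),
          X (m + i) ω = x i ∧ S (m + i) ω ∈ Prod.mk (x i) ⁻¹' t i} ∩ {ω | X (m + n) ω = k} =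
        {ω | ∀ i ∈ Finset.range (n + 1),
          X (m + i) ω = x i ∧ S (m + i) ω ∈ Prod.mk (x i) ⁻¹' t i} := by
      refine Set.inter_eq_left.2 fun ω hω => ?_
      exact (hω n (Finset.mem_range.2 (by omega))).1.trans hx
    rw [← Set.inter_assoc, h1, henv.law m n x _ hm]
    have h2 : {ω | ∀ i ∈ Finset.range (n + 1),
          X (m + i) ω = x i ∧ S (m + i) ω ∈ Prod.mk (x i) ⁻¹' t i} ∩
            {ω | X (m + n + 1) ω = l ∧ S (m + n + 1) ω ∈ B} =
        {ω | ∀ i ∈ Finset.range (n + 1 + 1), X (m + i) ω = (if i = n + 1 then l else x i) ∧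
          S (m + i) ω ∈ if i = n + 1 then B else Prod.mk (x i) ⁻¹' t i} := by
      ext ω
      constructor
      · rintro ⟨h1, h2⟩ i hi
        rcases eq_or_ne i (n + 1) with rfl | hne
        · simpa [add_assoc] using h2
        · simpa [hne] using h1 i (by simp at hi ⊢; omega)
      · intro h
        refine ⟨fun i hi => ?_, ?_⟩
        · have hne : i ≠ n + 1 := by simp at hi; omega
          simpa [hne] using h i (by simp at hi ⊢; omega)
        · simpa [add_assoc] using h (n + 1) (by simp)
    rw [h2, henv.law m (n + 1) (fun i => if i = n + 1 then l else x i)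
      (fun i => if i = n + 1 then B else Prod.mk (x i) ⁻¹' t i)
      (fun i => by by_cases hi : i = n + 1 <;> simp [hi, hB, hm])]
    rw [Finset.prod_range_succ _ (n + 1), Finset.prod_range_succ _ n]
    have e1 : ∏ i ∈ Finset.range n, P (if i = n + 1 then l else x i)
        (if i + 1 = n + 1 then l else x (i + 1)) = ∏ i ∈ Finset.range n, P (x i) (x (i + 1)) := by
      refine Finset.prod_congr rfl fun i hi => ?_
      have := Finset.mem_range.1 hi
      rw [if_neg (by omega), if_neg (by omega)]
    have e2 : ∏ i ∈ Finset.range (n + 1), ν (if i = n + 1 then l else x i)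
        (if i = n + 1 then B else Prod.mk (x i) ⁻¹' t i) =
        ∏ i ∈ Finset.range (n + 1), ν (x i) (Prod.mk (x i) ⁻¹' t i) := by
      refine Finset.prod_congr rfl fun i hi => ?_
      have := Finset.mem_range.1 hi
      rw [if_neg (by omega), if_neg (by omega)]
    rw [e1, e2, if_neg (by omega), if_neg (by omega), if_pos rfl, if_pos rfl, hx,
      ← mul_assoc (π (x 0)), ENNReal.ofReal_mul' (hP k l)]
    ring
  · have h1 : ∀ A : Set Ω, {ω | ∀ i ∈ Finset.range (n + 1),
          X (m + i) ω = x i ∧ S (m + i) ω ∈ Prod.mk (x i) ⁻¹' t i} ∩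
          ({ω | X (m + n) ω = k} ∩ A) = ∅ := by
      intro A
      refine Set.eq_empty_of_forall_notMem fun ω ⟨hω, hk, _⟩ => hx ?_
      rw [← (hω n (Finset.mem_range.2 (by omega))).1]; exact hk
    rw [h1, ← Set.inter_univ {ω | X (m + n) ω = k}, h1]
    simp

/-- The law of the past does not depend on the transition from which one looks back. -/
theorem IsPalmEnvironment.map_past (henv : IsPalmEnvironment P π ν Pr X S)
    [IsProbabilityMeasure Pr] (m m' : ℤ) : Pr.map (past X S m) = Pr.map (past X S m') := by
  have hm := henv.measurable_past
  have : IsProbabilityMeasure (Pr.map (past X S m)) :=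
    Measure.isProbabilityMeasure_map (hm m).aemeasurable
  refine ext_of_boxes fun n t ht => ?_
  have hbox : MeasurableSet {y : ℕ → Fin K × ℝ | ∀ i ∈ Finset.range (n + 1), y i ∈ t i} := by
    have : {y : ℕ → Fin K × ℝ | ∀ i ∈ Finset.range (n + 1), y i ∈ t i} =
        ⋂ i ∈ Finset.range (n + 1), (fun y => y i) ⁻¹' t i := by ext; simp
    rw [this]
    exact Finset.measurableSet_biInter _ fun i _ => measurable_pi_apply i (ht i)
  rw [Measure.map_apply (hm m) hbox, Measure.map_apply (hm m') hbox, preimage_past_box,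
    preimage_past_box]
  exact henv.box_shift _ _ n fun i => ht (n - i)

/-- The Markov property at the transition number `m`. -/
theorem IsPalmEnvironment.map_past_sojourn (henv : IsPalmEnvironment P π ν Pr X S)
    [IsProbabilityMeasure Pr] [∀ k, IsProbabilityMeasure (ν k)] (hP : ∀ i j, 0 ≤ P i j)
    (m : ℤ) (k l : Fin K) :
    (Pr.restrict ({ω | X (m - 1) ω = k} ∩ {ω | X m ω = l})).map (fun ω => (past X S m ω, S m ω)) =
      ENNReal.ofReal (P k l) •
        ((Pr.restrict {ω | X (m - 1) ω = k}).map (past X S m)).prod (ν l) := by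
  have hm := henv.measurable_past m
  have hX : ∀ j k, MeasurableSet {ω | X j ω = k} := fun j k =>
    henv.measurable_state j (measurableSet_singleton k)
  -- With `B` fixed, both sides are finite measures in the past alone, so boxes suffice; letting `B`
  -- vary then gives all the rectangles that determine the product measure.
  have hrect : ∀ {B : Set ℝ}, MeasurableSet B →
      (Pr.restrict ({ω | X (m - 1) ω = k} ∩ {ω | X m ω = l ∧ S m ω ∈ B})).map (past X S m) =
        (ENNReal.ofReal (P k l) * ν l B) •
          (Pr.restrict {ω | X (m - 1) ω = k}).map (past X S m) := by
    intro B hB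
    have : IsFiniteMeasure ((Pr.restrict ({ω | X (m - 1) ω = k} ∩
      {ω | X m ω = l ∧ S m ω ∈ B})).map (past X S m)) := inferInstance
    refine ext_of_boxes fun n t ht => ?_
    have hbox : MeasurableSet {y : ℕ → Fin K × ℝ | ∀ i ∈ Finset.range (n + 1), y i ∈ t i} := by
      have : {y : ℕ → Fin K × ℝ | ∀ i ∈ Finset.range (n + 1), y i ∈ t i} =
          ⋂ i ∈ Finset.range (n + 1), (fun y => y i) ⁻¹' t i := by ext; simp
      rw [this]
      exact Finset.measurableSet_biInter _ fun i _ => measurable_pi_apply i (ht i)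
    rw [Measure.smul_apply, Measure.map_apply hm hbox, Measure.map_apply hm hbox,
      Measure.restrict_apply (hm hbox), Measure.restrict_apply (hm hbox), preimage_past_box]
    have := henv.box_succ hP (m - 1 - n) n (fun i => ht (n - i)) k l hB
    have e1 : m - 1 - (n : ℤ) + n = m - 1 := by ring
    rw [e1, sub_add_cancel] at this
    rw [this, smul_eq_mul, mul_comm]
  have hpair : Measurable fun ω => (past X S m ω, S m ω) := hm.prodMk (henv.measurable_sojourn m)
  have : IsFiniteMeasure (ENNReal.ofReal (P k l) • ν l) :=
    Measure.smul_finite _ ENNReal.ofReal_ne_top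
  rw [← Measure.prod_smul_right]
  symm
  refine Measure.prod_eq (μ := (Pr.restrict {ω | X (m - 1) ω = k}).map (past X S m))
    (ν := ENNReal.ofReal (P k l) • ν l) fun A B hA hB => ?_
  have := congrArg (fun ρ => ρ A) (hrect hB)
  simp only [Measure.smul_apply, smul_eq_mul] at this
  rw [Measure.smul_apply, smul_eq_mul, mul_comm, ← this, Measure.map_apply hpair (hA.prod hB),
    Measure.map_apply hm hA, Measure.restrict_apply (hpair (hA.prod hB)),
    Measure.restrict_apply (hm hA)]
  congr 1
  ext ω
  simp only [Set.mem_inter_iff, Set.mem_preimage, Set.mem_prod, Set.mem_ofPred_eq]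
  tauto

/-- Split according to the preceding state `k`: on each piece the past and the sojourn have a
product law, weighted by `P k l`. -/
theorem IsPalmEnvironment.setIntegral_past_mul (henv : IsPalmEnvironment P π ν Pr X S)
    [IsProbabilityMeasure Pr] [∀ k, IsProbabilityMeasure (ν k)] (hP : ∀ i j, 0 ≤ P i j)
    (m : ℤ) (l : Fin K) {f : (ℕ → Fin K × ℝ) → ℝ} (hf : Measurable f) {g : ℝ → ℝ}
    (hg : Measurable g) (hfg : Integrable (fun ω => f (past X S m ω) * g (S m ω)) Pr) :
    ∫ ω in {ω | X m ω = l}, f (past X S m ω) * g (S m ω) ∂Pr =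
      (∑ k, P k l * ∫ ω in {ω | X (m - 1) ω = k}, f (past X S m ω) ∂Pr) * ∫ s, g s ∂(ν l) := by
  have hm := henv.measurable_past m
  have hX : ∀ j k, MeasurableSet {ω | X j ω = k} := fun j k =>
    henv.measurable_state j (measurableSet_singleton k)
  have hpair : Measurable fun ω => (past X S m ω, S m ω) := hm.prodMk (henv.measurable_sojourn m)
  have hU : {ω | X m ω = l} = ⋃ k, {ω | X (m - 1) ω = k} ∩ {ω | X m ω = l} := by
    ext ω; simp
  rw [hU, integral_iUnion_fintype (fun k => (hX _ k).inter (hX _ l)), Finset.sum_mul]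
  · refine Finset.sum_congr rfl fun k _ => ?_
    have hfgm : Measurable fun p : (ℕ → Fin K × ℝ) × ℝ => f p.1 * g p.2 :=
      (hf.comp measurable_fst).mul (hg.comp measurable_snd)
    rw [← integral_map (φ := fun ω => (past X S m ω, S m ω)) hpair.aemeasurable
      (f := fun p => f p.1 * g p.2) hfgm.aestronglyMeasurable,
      henv.map_past_sojourn hP, integral_smul_measure, integral_prod_mul,
      integral_map hm.aemeasurable hf.aestronglyMeasurable, ENNReal.toReal_ofReal (hP k l),
      smul_eq_mul, mul_assoc]
  · intro i j hij
    refine Set.disjoint_left.2 fun ω h1 h2 => hij ?_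
    exact h1.1.symm.trans h2.1
  · exact fun k => hfg.integrableOn

/-- The state `X (m - 1)` is coordinate 0 of the past, so the whole integral depends only on the law
of the past. -/
theorem IsPalmEnvironment.setIntegral_past_shift (henv : IsPalmEnvironment P π ν Pr X S)
    [IsProbabilityMeasure Pr] (m m' : ℤ) (k : Fin K) {f : (ℕ → Fin K × ℝ) → ℝ}
    (hf : Measurable f) :
    ∫ ω in {ω | X (m - 1) ω = k}, f (past X S m ω) ∂Pr =
      ∫ ω in {ω | X (m' - 1) ω = k}, f (past X S m' ω) ∂Pr := by
  have hset : MeasurableSet {y : ℕ → Fin K × ℝ | (y 0).1 = k} :=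
    ((measurable_fst.comp (measurable_pi_apply 0)) (measurableSet_singleton k))
  have key : ∀ m, ∫ ω in {ω | X (m - 1) ω = k}, f (past X S m ω) ∂Pr =
      ∫ y in {y | (y 0).1 = k}, f y ∂(Pr.map (past X S m)) := by
    intro m
    rw [setIntegral_map hset hf.aestronglyMeasurable (henv.measurable_past m).aemeasurable]
    simp [past]
  rw [key, key, henv.map_past m m']

end MMInfty

/-! ### Pathwise computation of `|A|` as a series over sojourns -/

namespace MMInfty

variable {K : ℕ}

theorem strictMono_epoch {s : ℤ → ℝ} (hs : ∀ n, 0 < s n) : StrictMono (epoch s) :=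
  strictMono_int_of_lt_succ fun m => by rw [epoch_succ]; linarith [hs m]

theorem measurable_envPath {x : ℤ → Fin K} {s : ℤ → ℝ} (hs : ∀ n, 0 < s n) :
    Measurable (envPath x s) := by
  have hmono := strictMono_epoch hs
  -- Epochs may accumulate, and `sSup` is 0 on empty or unbounded sets of integers. So only the
  -- levels `n ≠ 0` are intervals; level 0 is handled as the complement of the others.
  have key : ∀ n : ℤ, n ≠ 0 → (fun u : ℝ => sSup {m : ℤ | epoch s m ≤ u}) ⁻¹' {n} =
      Set.Ico (epoch s n) (epoch s (n + 1)) := by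
    intro n hn
    ext u
    constructor
    · intro h
      have h' : sSup {m : ℤ | epoch s m ≤ u} = n := h
      have hne : {m : ℤ | epoch s m ≤ u}.Nonempty := by
        by_contra h0
        rw [Set.not_nonempty_iff_eq_empty.1 h0] at h'
        exact hn (by simpa using h'.symm)
      have hbd : BddAbove {m : ℤ | epoch s m ≤ u} := by
        by_contra h0
        rw [Int.csSup_of_not_bddAbove h0] at h'
        exact hn h'.symm
      have hmem := Int.csSup_mem hne hbd
      rw [h'] at hmem
      refine ⟨hmem, ?_⟩
      by_contra h1
      have := le_csSup hbd (show n + 1 ∈ {m : ℤ | epoch s m ≤ u} from not_lt.1 h1)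
      omega
    · rintro ⟨h1, h2⟩
      have hg : IsGreatest {m : ℤ | epoch s m ≤ u} n := by
        refine ⟨h1, fun m hm => ?_⟩
        have hm' : epoch s m ≤ u := hm
        have := hmono.lt_iff_lt.1 (hm'.trans_lt h2)
        omega
      exact hg.csSup_eq
  have hmeas : Measurable fun u : ℝ => sSup {m : ℤ | epoch s m ≤ u} := by
    refine measurable_to_countable' fun n => ?_
    rcases eq_or_ne n 0 with rfl | hn
    · have : (fun u : ℝ => sSup {m : ℤ | epoch s m ≤ u}) ⁻¹' {0} =
          (⋃ n ∈ ({0}ᶜ : Set ℤ), (fun u : ℝ => sSup {m : ℤ | epoch s m ≤ u}) ⁻¹' {n})ᶜ := by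
        ext u
        simp only [Set.mem_preimage, Set.mem_singleton_iff, Set.mem_compl_iff, Set.mem_iUnion,
          not_exists]
        exact ⟨fun h i hi h' => hi (h'.symm.trans h), fun h => by_contra fun h' => h _ h' rfl⟩
      rw [this]
      refine (MeasurableSet.biUnion (Set.to_countable _) fun n hn => ?_).compl
      rw [key n hn]
      exact measurableSet_Ico
    · rw [key n hn]
      exact measurableSet_Ico
  exact (measurable_of_countable x).comp hmeas

section Path

variable {x : ℤ → Fin K} {s : ℤ → ℝ} (β lam : Fin K → ℝ) {μ : ℝ}

theorem intervalIntegrable_speed (hs : ∀ n, 0 < s n) (a b : ℝ) :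
    IntervalIntegrable (fun t => β (envPath x s t)) volume a b := by
  obtain ⟨C, hC⟩ := (Set.finite_range fun k => ‖β k‖).bddAbove
  refine (intervalIntegrable_const (c := C)).mono_fun'
    ((measurable_of_countable β).comp (measurable_envPath hs)).aestronglyMeasurable ?_
  exact Filter.Eventually.of_forall fun t => hC ⟨_, rfl⟩

theorem continuous_work (hs : ∀ n, 0 < s n) : Continuous (work β (envPath x s)) := by
  have : work β (envPath x s) = fun u => -∫ t in (0 : ℝ)..u, β (envPath x s t) := by
    funext u
    rw [work, intervalIntegral.integral_symm]
  rw [this]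
  exact (intervalIntegral.continuous_primitive (intervalIntegrable_speed β hs) 0).neg

theorem work_nonneg (hβ : ∀ k, 0 ≤ β k) (γ : ℝ → Fin K) {u : ℝ} (hu : u ≤ 0) :
    0 ≤ work β γ u :=
  intervalIntegral.integral_nonneg hu fun _ _ => hβ _

theorem expMeasure_Ioi (hμ : 0 < μ) {a : ℝ} (ha : 0 ≤ a) :
    expMeasure μ (Set.Ioi a) = ENNReal.ofReal (Real.exp (-(μ * a))) := by
  have := isProbabilityMeasure_expMeasure hμ
  have h1 : expMeasure μ (Set.Iic a) = ENNReal.ofReal (1 - Real.exp (-(μ * a))) := by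
    rw [← ofReal_cdf, cdf_expMeasure_eq hμ, if_pos ha]
  rw [← Set.compl_Iic, prob_compl_eq_one_sub measurableSet_Iic, h1, ← ENNReal.ofReal_one,
    ← ENNReal.ofReal_sub _ (by simp; positivity)]
  congr 1
  ring

/-- By Fubini: the section over `u < 0` is the half-line beyond the work `F(u) ≥ 0`, of exponential
mass `e^{-μ F(u)}`. -/
theorem intensity_presentSet (hs : ∀ n, 0 < s n) (hβ : ∀ k, 0 ≤ β k) (hμ : 0 < μ) :
    intensity lam μ (envPath x s) (presentSet β (envPath x s)) =
      ∫⁻ u in Set.Iio 0, ENNReal.ofReal (lam (envPath x s u)) *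
        ENNReal.ofReal (Real.exp (-(μ * work β (envPath x s) u))) := by
  have := isProbabilityMeasure_expMeasure hμ
  have hw := (continuous_work β (x := x) hs).measurable
  have hA : MeasurableSet (presentSet β (envPath x s)) :=
    (measurableSet_lt measurable_fst measurable_const).inter
      ((measurableSet_lt measurable_const measurable_snd).inter
        (measurableSet_lt (hw.comp measurable_fst) measurable_snd))
  have hl : Measurable fun u => ENNReal.ofReal (lam (envPath x s u)) :=
    ((measurable_of_countable lam).comp (measurable_envPath hs)).ennreal_ofReal
  rw [intensity, Measure.prod_apply hA,
    lintegral_withDensity_eq_lintegral_mul _ hl (measurable_measure_prodMk_left hA),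
    ← lintegral_indicator measurableSet_Iio]
  refine lintegral_congr fun u => ?_
  by_cases hu : u < 0
  · rw [Set.indicator_of_mem (Set.mem_Iio.2 hu), Pi.mul_apply]
    have h0 := work_nonneg β hβ (envPath x s) hu.le
    have : Prod.mk u ⁻¹' presentSet β (envPath x s) = Set.Ioi (work β (envPath x s) u) := by
      ext σ
      constructor
      · exact fun h => h.2.2
      · exact fun h => ⟨hu, h0.trans_lt h, h⟩
    rw [this, expMeasure_Ioi hμ h0]
  · rw [Set.indicator_of_notMem (by simpa using hu), Pi.mul_apply]
    have : Prod.mk u ⁻¹' presentSet β (envPath x s) = ∅ :=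
      Set.eq_empty_of_forall_notMem fun σ h => hu h.1
    rw [this]
    simp

theorem envPath_of_mem_Ico (hs : ∀ n, 0 < s n) (j : ℕ) {u : ℝ}
    (hu : u ∈ Set.Ico (epoch s (-(j + 1 : ℕ))) (epoch s (-j))) :
    envPath x s u = x (-1 - j) := by
  have e1 : (-1 - j : ℤ) = -((j + 1 : ℕ) : ℤ) := by push_cast; ring
  refine envPath_eq x s hs _ u (by rw [e1]; exact hu.1) ?_
  have e2 : (-1 - j + 1 : ℤ) = -j := by ring
  rw [e2]
  exact hu.2

theorem epoch_neg_succ (s : ℤ → ℝ) (j : ℕ) :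
    epoch s (-(j + 1 : ℕ)) = epoch s (-j) - s (-1 - j) := by
  have := epoch_succ s (-1 - j)
  have e1 : (-1 - j : ℤ) = -((j + 1 : ℕ) : ℤ) := by push_cast; ring
  have e2 : (-1 - j + 1 : ℤ) = -j := by ring
  rw [e2] at this
  rw [← e1]
  linarith

theorem work_of_mem_Icc (hs : ∀ n, 0 < s n) (j : ℕ) {u : ℝ}
    (hu : u ∈ Set.Icc (epoch s (-(j + 1 : ℕ))) (epoch s (-j))) :
    work β (envPath x s) u = ∑ i ∈ Finset.range j, β (x (-1 - i)) * s (-1 - i) +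
      β (x (-1 - j)) * (epoch s (-j) - u) := by
  have hint := intervalIntegrable_speed (x := x) β hs
  have hpiece : ∀ (j : ℕ) (u : ℝ), u ∈ Set.Icc (epoch s (-(j + 1 : ℕ))) (epoch s (-j)) →
      work β (envPath x s) u =
        work β (envPath x s) (epoch s (-j)) + β (x (-1 - j)) * (epoch s (-j) - u) := by
    intro j u hu
    have h1 : ∫ t in u..epoch s (-j), β (envPath x s t) =
        β (x (-1 - j)) * (epoch s (-j) - u) := by
      -- The right endpoint is dropped because there the path has already entered the next state.
      rw [intervalIntegral.integral_of_le hu.2, integral_Ioc_eq_integral_Ioo,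
        setIntegral_congr_fun (g := fun _ => β (x (-1 - j))) measurableSet_Ioo,
        ← integral_Ioc_eq_integral_Ioo, ← intervalIntegral.integral_of_le hu.2,
        intervalIntegral.integral_const, smul_eq_mul, mul_comm]
      intro t ht
      simp only
      rw [envPath_of_mem_Ico hs j ⟨hu.1.trans ht.1.le, ht.2⟩]
    rw [work, work, ← h1, add_comm, intervalIntegral.integral_add_adjacent_intervals
      (hint _ _) (hint _ _)]
  have hepoch : ∀ j : ℕ, work β (envPath x s) (epoch s (-j)) =
      ∑ i ∈ Finset.range j, β (x (-1 - i)) * s (-1 - i) := by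
    intro j
    induction j with
    | zero => simp [work, epoch_zero]
    | succ j ih =>
      have hle : epoch s (-(j + 1 : ℕ)) ≤ epoch s (-j) := by
        rw [epoch_neg_succ]; linarith [hs (-1 - j)]
      rw [hpiece j _ ⟨le_rfl, hle⟩, ih, Finset.sum_range_succ, epoch_neg_succ]
      ring
  rw [hpiece j u hu, hepoch]

end Path

/-- When `r = 0` the hypothesis forces `l = 0`, and `l / r = 0` is then the right value; this is
where the convention `ρ_k = 0` enters. -/
theorem integral_const_mul_exp {l r a b c : ℝ} (hr : r = 0 → l = 0) :
    ∫ u in a..b, l * Real.exp (-(c + r * (b - u))) =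
      l / r * (1 - Real.exp (-(r * (b - a)))) * Real.exp (-c) := by
  rcases eq_or_ne r 0 with h0 | h0
  · simp [hr h0]
  · have hd : ∀ u ∈ Set.uIcc a b, HasDerivAt (fun u => l / r * Real.exp (-(c + r * (b - u))))
        (l * Real.exp (-(c + r * (b - u)))) u := by
      intro u _
      have h1 : HasDerivAt (fun u => -(c + r * (b - u))) r u := by
        have := ((((hasDerivAt_id u).const_sub b).const_mul r).const_add c).fun_neg
        simpa using this
      exact (h1.exp.const_mul (l / r)).congr_deriv (by field_simp)
    rw [intervalIntegral.integral_eq_sub_of_hasDerivAt hd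
      (Continuous.intervalIntegrable (by fun_prop) _ _)]
    have e : Real.exp (-(c + r * (b - a))) = Real.exp (-(r * (b - a))) * Real.exp (-c) := by
      rw [← Real.exp_add]; congr 1; ring
    rw [e]
    simp
    ring

/-- The contribution to `|A|` of the sojourn number `-1 - j`, in terms of the past `y`. -/
noncomputable def contribution (lam β : Fin K → ℝ) (μ : ℝ) (y : ℕ → Fin K × ℝ) (j : ℕ) : ℝ :=
  lam (y j).1 / (μ * β (y j).1) * (1 - Real.exp (-(μ * β (y j).1 * (y j).2))) *
    Real.exp (-∑ i ∈ Finset.range j, μ * β (y i).1 * (y i).2)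

/-- Within one sojourn the arrival rate is constant and the work is affine in `u`, so the integrand
is an explicit exponential. -/
theorem setLIntegral_sojourn {x : ℤ → Fin K} {s : ℤ → ℝ} {lam β : Fin K → ℝ} {μ : ℝ}
    (hs : ∀ n, 0 < s n) (hlam : ∀ k, 0 ≤ lam k) (hμ : 0 < μ)
    (h0 : ∀ k, β k = 0 → lam k = 0) (j : ℕ) :
    ∫⁻ u in Set.Ico (epoch s (-(j + 1 : ℕ))) (epoch s (-j)),
      ENNReal.ofReal (lam (envPath x s u)) *
        ENNReal.ofReal (Real.exp (-(μ * work β (envPath x s) u))) =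
      ENNReal.ofReal (contribution lam β μ (fun i => (x (-1 - i), s (-1 - i))) j) := by
  set b := epoch s (-j) with hb
  set a := epoch s (-(j + 1 : ℕ)) with ha
  have hab : a ≤ b := by rw [ha, epoch_neg_succ]; linarith [hs (-1 - j)]
  set c := ∑ i ∈ Finset.range j, μ * β (x (-1 - i)) * s (-1 - i) with hc
  have hcongr : ∀ u ∈ Set.Ico a b, ENNReal.ofReal (lam (envPath x s u)) *
        ENNReal.ofReal (Real.exp (-(μ * work β (envPath x s) u))) =
      ENNReal.ofReal (lam (x (-1 - j)) *
        Real.exp (-(c + μ * β (x (-1 - j)) * (b - u)))) := by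
    intro u hu
    rw [envPath_of_mem_Ico hs j hu, work_of_mem_Icc β hs j ⟨hu.1, hu.2.le⟩,
      ← ENNReal.ofReal_mul (hlam _)]
    congr 4
    rw [hc, mul_add, Finset.mul_sum]
    simp only [mul_assoc, hb]
  have hcont : Continuous fun u => lam (x (-1 - j)) *
      Real.exp (-(c + μ * β (x (-1 - j)) * (b - u))) := by fun_prop
  rw [setLIntegral_congr_fun measurableSet_Ico hcongr,
    ← ofReal_integral_eq_lintegral_ofReal
      ((hcont.integrableOn_Icc (a := a) (b := b)).mono_set Set.Ico_subset_Icc_self)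
      (Filter.Eventually.of_forall fun u => mul_nonneg (hlam _) (Real.exp_nonneg _)),
    integral_Ico_eq_integral_Ioc, ← intervalIntegral.integral_of_le hab, integral_const_mul_exp]
  · have : b - a = s (-1 - j) := by rw [ha, epoch_neg_succ]; ring
    rw [this]
    rfl
  · intro h
    exact h0 _ ((mul_eq_zero.1 h).resolve_left hμ.ne')

/-- `hinf` excludes accumulation of epochs in negative time, so the sojourn intervals tile the
negative half-line. -/
theorem intensity_presentSet_eq_tsum {x : ℤ → Fin K} {s : ℤ → ℝ} {lam β : Fin K → ℝ} {μ : ℝ}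
    (hs : ∀ n, 0 < s n) (hlam : ∀ k, 0 ≤ lam k) (hβ : ∀ k, 0 ≤ β k) (hμ : 0 < μ)
    (h0 : ∀ k, β k = 0 → lam k = 0) (hinf : ∀ u < 0, ∃ N : ℕ, epoch s (-N) ≤ u) :
    intensity lam μ (envPath x s) (presentSet β (envPath x s)) =
      ∑' j, ENNReal.ofReal (contribution lam β μ (fun i => (x (-1 - i), s (-1 - i))) j) := by
  have hmono := strictMono_epoch hs
  have hanti : Antitone fun j : ℕ => epoch s (-j) := fun i j hij =>
    hmono.monotone (by omega)
  have hU : Set.Iio (0 : ℝ) = ⋃ j : ℕ, Set.Ico (epoch s (-(j + 1 : ℕ))) (epoch s (-j)) := by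
    ext u
    simp only [Set.mem_Iio, Set.mem_iUnion, Set.mem_Ico]
    constructor
    · intro hu
      classical
      have hex := hinf u hu
      have hne : Nat.find hex ≠ 0 := by
        intro h
        have := Nat.find_spec hex
        rw [h] at this
        simp [epoch_zero] at this
        linarith
      obtain ⟨j, hj⟩ := Nat.exists_eq_succ_of_ne_zero hne
      refine ⟨j, ?_, not_le.1 (Nat.find_min hex (by omega))⟩
      have := Nat.find_spec hex
      rwa [hj] at this
    · rintro ⟨j, -, hj⟩
      refine hj.trans_le ?_
      have := hanti (Nat.zero_le j)
      simpa [epoch_zero] using this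
  have hdisj : Pairwise (Function.onFun Disjoint fun j : ℕ =>
      Set.Ico (epoch s (-(j + 1 : ℕ))) (epoch s (-j))) := hanti.pairwise_disjoint_on_Ico_succ
  rw [intensity_presentSet β lam hs hβ hμ, hU,
    lintegral_iUnion (fun j => measurableSet_Ico) hdisj]
  exact tsum_congr fun j => setLIntegral_sojourn hs hlam hμ h0 j

end MMInfty

/-! ### Laplace transforms and nonsingularity of `B'_n` -/

namespace MMInfty

section Laplace

variable {ν : Measure ℝ}

theorem ae_pos_of_Iic (hν : ν (Set.Iic 0) = 0) : ∀ᵐ t ∂ν, 0 < t := by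
  rw [ae_iff]
  convert hν using 2
  ext t
  simp

variable [IsProbabilityMeasure ν]

theorem integrable_exp_neg_mul (hν : ν (Set.Iic 0) = 0) {s : ℝ} (hs : 0 ≤ s) :
    Integrable (fun t => Real.exp (-(s * t))) ν := by
  refine Integrable.of_bound (by fun_prop) 1 ?_
  filter_upwards [ae_pos_of_Iic hν] with t ht
  rw [Real.norm_eq_abs, Real.abs_exp, Real.exp_le_one_iff]
  have := mul_nonneg hs ht.le
  linarith

theorem laplaceTransform_pos (hν : ν (Set.Iic 0) = 0) {s : ℝ} (hs : 0 ≤ s) :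
    0 < laplaceTransform ν s :=
  integral_exp_pos (integrable_exp_neg_mul hν hs)

theorem laplaceTransform_le_one (hν : ν (Set.Iic 0) = 0) {s : ℝ} (hs : 0 ≤ s) :
    laplaceTransform ν s ≤ 1 := by
  have h : laplaceTransform ν s ≤ ∫ _, (1 : ℝ) ∂ν := by
    refine integral_mono_ae (integrable_exp_neg_mul hν hs) (integrable_const _) ?_
    filter_upwards [ae_pos_of_Iic hν] with t ht
    rw [Real.exp_le_one_iff]
    have := mul_nonneg hs ht.le
    linarith
  simpa using h

theorem laplaceTransform_lt_one (hν : ν (Set.Iic 0) = 0) {s : ℝ} (hs : 0 < s) :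
    laplaceTransform ν s < 1 := by
  have hlt : ∀ᵐ t ∂ν, 0 < 1 - Real.exp (-(s * t)) := by
    filter_upwards [ae_pos_of_Iic hν] with t ht
    have := Real.exp_lt_one_iff.2 (neg_lt_zero.2 (mul_pos hs ht))
    linarith
  have hint := (integrable_const (1 : ℝ)).sub (integrable_exp_neg_mul hν hs.le)
  have h : 0 < ∫ t, (1 - Real.exp (-(s * t))) ∂ν := by
    refine (integral_pos_iff_support_of_nonneg_ae (hlt.mono fun _ h => h.le) hint).2 ?_
    have : ν (Function.support fun t => 1 - Real.exp (-(s * t))) = ν Set.univ :=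
      measure_congr (Filter.eventuallyEq_univ.2 (hlt.mono fun _ h => h.ne'))
    rw [this, measure_univ]
    exact one_pos
  rw [integral_sub (integrable_const _) (integrable_exp_neg_mul hν hs.le)] at h
  simp only [integral_const, probReal_univ, smul_eq_mul, mul_one] at h
  unfold laplaceTransform
  linarith

end Laplace

/-- Perturbing an irreducible stochastic matrix on the diagonal: if `d ≥ 1` with strict inequality
at some place, then `diag d - P` is nonsingular. -/
theorem isUnit_diagonal_sub {K : ℕ} {P : Matrix (Fin K) (Fin K) ℝ}
    (hP : P ∈ Matrix.rowStochastic ℝ (Fin K)) (hirr : P.IsIrreducible) {d : Fin K → ℝ}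
    (hd : ∀ k, 1 ≤ d k) {k₀ : Fin K} (hk₀ : 1 < d k₀) :
    IsUnit (Matrix.diagonal d - P) := by
  have hsum := (Matrix.mem_rowStochastic_iff_sum.1 hP).2
  rw [← Matrix.mulVec_injective_iff_isUnit]
  refine (injective_iff_map_eq_zero ((Matrix.diagonal d - P).mulVecLin)).2 fun v hv => ?_
  have heq : ∀ k, d k * v k = ∑ j, P k j * v j := by
    intro k
    have h : ((Matrix.diagonal d - P) *ᵥ v) k = 0 := congrFun hv k
    rw [Matrix.sub_mulVec, Pi.sub_apply, Matrix.mulVec_diagonal] at h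
    exact sub_eq_zero.1 h
  obtain ⟨m, -, hm⟩ := Finset.exists_max_image Finset.univ (fun k => |v k|) ⟨k₀, Finset.mem_univ _⟩
  have hle : ∀ k, d k * |v k| ≤ ∑ j, P k j * |v j| := by
    intro k
    calc d k * |v k| = |d k * v k| := by
          rw [abs_mul, abs_of_nonneg (zero_le_one.trans (hd k))]
      _ = |∑ j, P k j * v j| := by rw [heq]
      _ ≤ ∑ j, |P k j * v j| := Finset.abs_sum_le_sum_abs _ _
      _ = ∑ j, P k j * |v j| := by simp only [abs_mul, abs_of_nonneg (hirr.nonneg k _)]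
  have hmax : ∀ k, ∑ j, P k j * |v j| ≤ |v m| := by
    intro k
    calc ∑ j, P k j * |v j| ≤ ∑ j, P k j * |v m| :=
          Finset.sum_le_sum fun j hj => mul_le_mul_of_nonneg_left (hm j hj) (hirr.nonneg k j)
      _ = |v m| := by rw [← Finset.sum_mul, hsum, one_mul]
  -- At a maximiser of `|v|` the `P`-average of `|v|` must attain the maximum, so every successor is
  -- a maximiser too; irreducibility carries this to `k₀`, where `d k₀ > 1` forces the maximum to
  -- vanish.
  have hstep : ∀ i j, 0 < P i j → |v i| = |v m| → |v j| = |v m| := by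
    intro i j hij hi
    by_contra hne
    have hlt : |v j| < |v m| := lt_of_le_of_ne (hm j (Finset.mem_univ j)) hne
    have h1 : ∑ l, P i l * |v l| < ∑ l, P i l * |v m| :=
      Finset.sum_lt_sum
        (fun l hl => mul_le_mul_of_nonneg_left (hm l hl) (hirr.nonneg i l))
        ⟨j, Finset.mem_univ j, mul_lt_mul_of_pos_left hlt hij⟩
    rw [← Finset.sum_mul, hsum, one_mul] at h1
    have h2 := hle i
    rw [hi] at h2
    have h3 := mul_le_mul_of_nonneg_right (hd i) (abs_nonneg (v m))
    linarith
  have hall : |v k₀| = |v m| := by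
    let : Quiver (Fin K) := Matrix.toQuiver P
    obtain ⟨p, -⟩ := hirr.connected m k₀
    have : ∀ (j : Fin K) (q : Quiver.Path m j), |v j| = |v m| := by
      intro j q
      induction q with
      | nil => rfl
      | cons q e ih => exact hstep _ _ e.down ih
    exact this k₀ p
  have h0 : |v m| = 0 := by
    have h1 := (hle k₀).trans (hmax k₀)
    rw [hall] at h1
    have h2 : 0 ≤ |v m| := abs_nonneg _
    nlinarith
  funext k
  have := hm k (Finset.mem_univ k)
  rw [h0] at this
  exact abs_eq_zero.1 (le_antisymm this (abs_nonneg _))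

theorem isUnit_matB' {K : ℕ} {P : Matrix (Fin K) (Fin K) ℝ}
    (hP : P ∈ Matrix.rowStochastic ℝ (Fin K)) (hirr : P.IsIrreducible)
    {ν : Fin K → Measure ℝ} [∀ k, IsProbabilityMeasure (ν k)] (hν : ∀ k, ν k (Set.Iic 0) = 0)
    {β : Fin K → ℝ} {μ : ℝ} (hβ : ∀ k, 0 ≤ β k) (hβpos : ∃ k, 0 < β k) (hμ : 0 < μ)
    {n : ℕ} (hn : 0 < n) : IsUnit (matB' P ν β μ n) := by
  obtain ⟨k₀, hk₀⟩ := hβpos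
  have hn' : (0 : ℝ) < n := Nat.cast_pos.2 hn
  have h0 : ∀ k, 0 ≤ (n : ℝ) * (μ * β k) := fun k =>
    mul_nonneg hn'.le (mul_nonneg hμ.le (hβ k))
  exact isUnit_diagonal_sub hP hirr
    (fun k => (one_le_inv₀ (laplaceTransform_pos (hν k) (h0 k))).2
      (laplaceTransform_le_one (hν k) (h0 k)))
    ((one_lt_inv₀ (laplaceTransform_pos (hν k₀) (h0 k₀))).2
      (laplaceTransform_lt_one (hν k₀) (mul_pos hn' (mul_pos hμ hk₀))))

end MMInfty

/-! ### Recursion and uniform bound for the partial sums -/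

namespace MMInfty

section PartialSums

variable {K : ℕ} {lam β : Fin K → ℝ} {μ : ℝ}

theorem contribution_nonneg (hlam : ∀ k, 0 ≤ lam k) (hβ : ∀ k, 0 ≤ β k) (hμ : 0 < μ)
    {y : ℕ → Fin K × ℝ} (hy : ∀ j, 0 < (y j).2) (j : ℕ) : 0 ≤ contribution lam β μ y j := by
  have h1 : 0 ≤ μ * β (y j).1 := mul_nonneg hμ.le (hβ _)
  have h2 : Real.exp (-(μ * β (y j).1 * (y j).2)) ≤ 1 := by
    rw [Real.exp_le_one_iff, neg_nonpos]
    exact mul_nonneg h1 (hy j).le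
  exact mul_nonneg (mul_nonneg (div_nonneg (hlam _) h1) (by linarith)) (Real.exp_nonneg _)

theorem measurable_sum_contribution (N : ℕ) :
    Measurable fun y : ℕ → Fin K × ℝ => ∑ j ∈ Finset.range N, contribution lam β μ y j := by
  have hβm : ∀ i : ℕ, Measurable fun y : ℕ → Fin K × ℝ => β (y i).1 := fun i =>
    (measurable_of_countable β).comp (measurable_fst.comp (measurable_pi_apply i))
  have hρm : ∀ i : ℕ, Measurable fun y : ℕ → Fin K × ℝ => lam (y i).1 / (μ * β (y i).1) :=
    fun i => (measurable_of_countable fun k => lam k / (μ * β k)).comp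
      (measurable_fst.comp (measurable_pi_apply i))
  have hsm : ∀ i : ℕ, Measurable fun y : ℕ → Fin K × ℝ => (y i).2 := fun i =>
    measurable_snd.comp (measurable_pi_apply i)
  have hprod : ∀ i : ℕ, Measurable fun y : ℕ → Fin K × ℝ => μ * β (y i).1 * (y i).2 := fun i =>
    (measurable_const.mul (hβm i)).mul (hsm i)
  refine Finset.measurable_fun_sum _ fun j _ => ?_
  exact ((hρm j).mul (measurable_const.sub (hprod j).neg.exp)).mul
    (Finset.measurable_fun_sum _ fun i _ => hprod i).neg.exp

/-- The renewal recursion: every contribution older than the latest sojourn carries that sojourn's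
discount factor. -/
theorem sum_contribution_succ (y : ℕ → Fin K × ℝ) (N : ℕ) :
    ∑ j ∈ Finset.range (N + 1), contribution lam β μ y j =
      lam (y 0).1 / (μ * β (y 0).1) * (1 - Real.exp (-(μ * β (y 0).1 * (y 0).2))) +
        Real.exp (-(μ * β (y 0).1 * (y 0).2)) *
          ∑ j ∈ Finset.range N, contribution lam β μ (fun i => y (i + 1)) j := by
  rw [Finset.sum_range_succ', add_comm, Finset.mul_sum]
  congr 1
  · simp [contribution]
  · refine Finset.sum_congr rfl fun j _ => ?_
    rw [contribution, contribution, Finset.sum_range_succ', neg_add, Real.exp_add]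
    ring

/-- By the recursion, the sum is a convex combination of a ratio `ρ_k` and a shorter sum over the
shifted past; hence the induction over all `y`. -/
theorem sum_contribution_le (hβ : ∀ k, 0 ≤ β k) (hμ : 0 < μ) {C : ℝ} (hC0 : 0 ≤ C)
    (hC : ∀ k, lam k / (μ * β k) ≤ C) (N : ℕ) {y : ℕ → Fin K × ℝ} (hy : ∀ j, 0 < (y j).2) :
    ∑ j ∈ Finset.range N, contribution lam β μ y j ≤ C := by
  induction N generalizing y with
  | zero => simpa using hC0
  | succ N ih =>
    rw [sum_contribution_succ]
    set e := Real.exp (-(μ * β (y 0).1 * (y 0).2)) with he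
    have h1 : e ≤ 1 := by
      rw [he, Real.exp_le_one_iff, neg_nonpos]
      exact mul_nonneg (mul_nonneg hμ.le (hβ _)) (hy 0).le
    have h2 := mul_le_mul_of_nonneg_right (hC (y 0).1) (sub_nonneg.2 h1)
    have h3 := mul_le_mul_of_nonneg_left (ih fun j => hy (j + 1)) (Real.exp_nonneg
      (-(μ * β (y 0).1 * (y 0).2)))
    rw [← he] at h3
    linarith

end PartialSums

/-! ### Almost sure finiteness of `|A|` and the moment recursion -/

section Environment

variable {K : ℕ} {P : Matrix (Fin K) (Fin K) ℝ} {π : Fin K → ℝ} {ν : Fin K → Measure ℝ}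
  {Ω : Type*} {X : ℤ → Ω → Fin K} {S : ℤ → Ω → ℝ}

theorem past_succ (m : ℤ) (ω : Ω) :
    (fun i => past X S m ω (i + 1)) = past X S (m - 1) ω := by
  funext i
  have : m - 1 - ((i + 1 : ℕ) : ℤ) = m - 1 - 1 - i := by push_cast; ring
  simp only [past, this]

variable [MeasurableSpace Ω] {Pr : Measure Ω}

theorem IsPalmEnvironment.measure_state (henv : IsPalmEnvironment P π ν Pr X S)
    [∀ k, IsProbabilityMeasure (ν k)] (m : ℤ) (k : Fin K) :
    Pr {ω | X m ω = k} = ENNReal.ofReal (π k) := by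
  simpa using henv.law m 0 (fun _ => k) (fun _ => Set.univ) fun _ => MeasurableSet.univ

theorem IsPalmEnvironment.ae_sojourn_pos (henv : IsPalmEnvironment P π ν Pr X S)
    (hν : ∀ k, ν k (Set.Iic 0) = 0) : ∀ᵐ ω ∂Pr, ∀ n, 0 < S n ω := by
  rw [ae_all_iff]
  intro n
  have h : ∀ᵐ ω ∂Pr, ∀ k, ¬ (X n ω = k ∧ S n ω ∈ Set.Iic 0) := by
    rw [ae_all_iff]
    intro k
    rw [ae_iff]
    have := henv.law n 0 (fun _ => k) (fun _ => Set.Iic 0) fun _ => measurableSet_Iic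
    simpa [hν] using this
  filter_upwards [h] with ω hω
  by_contra hneg
  exact hω (X n ω) ⟨rfl, not_lt.1 hneg⟩

/-- The sojourn times before the origin have an infinite sum. -/
theorem IsPalmEnvironment.ae_tsum_sojourn (henv : IsPalmEnvironment P π ν Pr X S)
    [IsProbabilityMeasure Pr] (hν : ∀ k, ν k (Set.Iic 0) = 0) :
    ∀ᵐ ω ∂Pr, ∑' j, ENNReal.ofReal (past X S 0 ω j).2 = ∞ := by
  set V : (ℕ → Fin K × ℝ) → ℝ≥0∞ := fun y => ∑' j, ENNReal.ofReal (y j).2 with hV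
  have hVm : Measurable V := Measurable.tsum fun j =>
    (measurable_snd.comp (measurable_pi_apply j)).ennreal_ofReal
  -- `V` may fail to be integrable, so a bounded decreasing function of it is used. Its integrals at
  -- transitions `0` and `-1` agree, while `V` gains `S (-1)` pointwise; equality therefore holds
  -- almost surely, and `S (-1) > 0` rules out a finite `V`.
  have hφ : Measurable fun y => (1 + V y)⁻¹ := (measurable_const.add hVm).inv
  have hsucc : ∀ ω, V (past X S 0 ω) =
      ENNReal.ofReal (S (-1) ω) + V (past X S (-1) ω) := by
    intro ω
    have h := past_succ (X := X) (S := S) 0 ω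
    rw [zero_sub] at h
    rw [← h, hV]
    simp only
    rw [tsum_eq_zero_add' ENNReal.summable]
    simp [past]
  have hint : ∫⁻ ω, (1 + V (past X S 0 ω))⁻¹ ∂Pr = ∫⁻ ω, (1 + V (past X S (-1) ω))⁻¹ ∂Pr := by
    rw [← lintegral_map hφ (henv.measurable_past 0), ← lintegral_map hφ (henv.measurable_past (-1)),
      henv.map_past 0 (-1)]
  have hle : ∀ ω, (1 + V (past X S 0 ω))⁻¹ ≤ (1 + V (past X S (-1) ω))⁻¹ := by
    intro ω
    rw [hsucc]
    gcongr
    exact le_add_self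
  have hfin : ∫⁻ ω, (1 + V (past X S 0 ω))⁻¹ ∂Pr ≠ ∞ := by
    refine ne_top_of_le_ne_top (b := 1) ENNReal.one_ne_top ?_
    calc ∫⁻ ω, (1 + V (past X S 0 ω))⁻¹ ∂Pr ≤ ∫⁻ _, 1 ∂Pr :=
          lintegral_mono fun ω => ENNReal.inv_le_one.2 le_self_add
      _ = 1 := by simp
  have hae := ae_eq_of_ae_le_of_lintegral_le (Filter.Eventually.of_forall hle) hfin
    (hφ.comp (henv.measurable_past (-1))).aemeasurable hint.ge
  filter_upwards [hae, henv.ae_sojourn_pos hν] with ω h1 h2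
  have h3 : 1 + V (past X S 0 ω) = 1 + V (past X S (-1) ω) := inv_injective h1
  have h4 : V (past X S 0 ω) = V (past X S (-1) ω) := by
    rwa [ENNReal.add_right_inj ENNReal.one_ne_top] at h3
  change V (past X S 0 ω) = ∞
  by_contra hne
  have h5 := hsucc ω
  rw [← h4] at h5
  have h6 : V (past X S 0 ω) < ENNReal.ofReal (S (-1) ω) + V (past X S 0 ω) := by
    rw [add_comm]
    exact ENNReal.lt_add_right hne (ENNReal.ofReal_pos.2 (h2 (-1))).ne'
  exact h6.ne h5

theorem epoch_neg_eq_sum (s : ℤ → ℝ) (N : ℕ) :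
    epoch s (-N) = -∑ j ∈ Finset.range N, s (-1 - j) := by
  induction N with
  | zero => simp [epoch_zero]
  | succ N ih => rw [epoch_neg_succ, ih, Finset.sum_range_succ]; ring

theorem exists_epoch_le {s : ℤ → ℝ} (hs : ∀ n, 0 < s n)
    (h : ∑' j : ℕ, ENNReal.ofReal (s (-1 - j)) = ∞) (u : ℝ) : ∃ N : ℕ, epoch s (-N) ≤ u := by
  by_contra! hcon
  have : ∑' j : ℕ, ENNReal.ofReal (s (-1 - j)) ≤ ENNReal.ofReal (-u) := by
    refine ENNReal.tsum_le_of_sum_range_le fun N => ?_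
    rw [← ENNReal.ofReal_sum_of_nonneg fun j _ => (hs _).le]
    refine ENNReal.ofReal_le_ofReal ?_
    have := hcon N
    rw [epoch_neg_eq_sum] at this
    linarith
  rw [h] at this
  exact ENNReal.ofReal_ne_top (top_le_iff.1 this)

variable {lam β : Fin K → ℝ} {μ : ℝ}

theorem IsPalmEnvironment.ae_presentMeasure (henv : IsPalmEnvironment P π ν Pr X S)
    [IsProbabilityMeasure Pr] (hν : ∀ k, ν k (Set.Iic 0) = 0) (hlam : ∀ k, 0 ≤ lam k)
    (hβ : ∀ k, 0 ≤ β k) (hμ : 0 < μ) (h0 : ∀ k, β k = 0 → lam k = 0) {C : ℝ} (hC0 : 0 ≤ C)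
    (hC : ∀ k, lam k / (μ * β k) ≤ C) :
    ∀ᵐ ω ∂Pr, presentMeasure lam β μ X S ω < ∞ ∧
      Filter.Tendsto (fun N => ∑ j ∈ Finset.range N, contribution lam β μ (past X S 0 ω) j)
        Filter.atTop (nhds (presentMeasure lam β μ X S ω).toReal) := by
  filter_upwards [henv.ae_sojourn_pos hν, henv.ae_tsum_sojourn hν] with ω h1 h2
  have hpast : past X S 0 ω = fun i : ℕ => (X (-1 - i) ω, S (-1 - i) ω) := by
    funext i; simp [past]
  rw [hpast] at h2 ⊢
  set y : ℕ → Fin K × ℝ := fun i => (X (-1 - i) ω, S (-1 - i) ω) with hy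
  have hypos : ∀ j, 0 < (y j).2 := fun j => h1 _
  have hnn := contribution_nonneg hlam hβ hμ hypos
  have hsum : Summable (contribution lam β μ y) :=
    summable_of_sum_range_le hnn fun N => sum_contribution_le hβ hμ hC0 hC N hypos
  have hval : presentMeasure lam β μ X S ω = ENNReal.ofReal (∑' j, contribution lam β μ y j) := by
    rw [ENNReal.ofReal_tsum_of_nonneg hnn hsum]
    exact intensity_presentSet_eq_tsum (x := fun n => X n ω) (s := fun n => S n ω) h1 hlam hβ hμ h0
      fun u _ => exists_epoch_le (s := fun n => S n ω) h1 h2 u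
  rw [hval, ENNReal.toReal_ofReal (tsum_nonneg hnn)]
  exact ⟨ENNReal.ofReal_lt_top, hsum.hasSum.tendsto_sum_nat⟩

theorem abs_sub_sum_contribution_le (hlam : ∀ k, 0 ≤ lam k) (hβ : ∀ k, 0 ≤ β k) (hμ : 0 < μ)
    {C : ℝ} (hC0 : 0 ≤ C) (hC : ∀ k, lam k / (μ * β k) ≤ C) {y : ℕ → Fin K × ℝ}
    (hy : ∀ j, 0 < (y j).2) (c : ℝ) (N : ℕ) :
    |c - ∑ j ∈ Finset.range N, contribution lam β μ y j| ≤ |c| + C := by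
  have h1 := sum_contribution_le hβ hμ hC0 hC N hy
  have h2 := Finset.sum_nonneg fun j (_ : j ∈ Finset.range N) =>
    contribution_nonneg hlam hβ hμ hy j
  calc _ ≤ |c| + |∑ j ∈ Finset.range N, contribution lam β μ y j| := abs_sub _ _
    _ ≤ |c| + C := by rw [abs_of_nonneg h2]; linarith

/-- The recursion makes `ρ_l` minus the sum factor as `e^{-μ_l S}` times the same difference for the
earlier past. Its `n`-th power is a function of the past times one of the sojourn, so the Markov
property and then stationarity apply. -/
theorem IsPalmEnvironment.setIntegral_pow_sum_succ (henv : IsPalmEnvironment P π ν Pr X S)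
    [IsProbabilityMeasure Pr] [∀ k, IsProbabilityMeasure (ν k)] (hP : ∀ i j, 0 ≤ P i j)
    (hν : ∀ k, ν k (Set.Iic 0) = 0) (hlam : ∀ k, 0 ≤ lam k)
    (hβ : ∀ k, 0 ≤ β k) (hμ : 0 < μ) {C : ℝ} (hC0 : 0 ≤ C)
    (hC : ∀ k, lam k / (μ * β k) ≤ C) (n N : ℕ) (l : Fin K) :
    ∫ ω in {ω | X (-1) ω = l}, (lam l / (μ * β l) -
        ∑ j ∈ Finset.range (N + 1), contribution lam β μ (past X S 0 ω) j) ^ n ∂Pr =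
      (∑ k, P k l * ∫ ω in {ω | X (-1) ω = k}, (lam l / (μ * β l) -
        ∑ j ∈ Finset.range N, contribution lam β μ (past X S 0 ω) j) ^ n ∂Pr) *
          laplaceTransform (ν l) (n * (μ * β l)) := by
  set ρ := lam l / (μ * β l) with hρ
  set f : (ℕ → Fin K × ℝ) → ℝ := fun y =>
    (ρ - ∑ j ∈ Finset.range N, contribution lam β μ y j) ^ n with hf
  set g : ℝ → ℝ := fun s => Real.exp (-(n * (μ * β l) * s)) with hg
  have hfm : Measurable f := (measurable_const.sub (measurable_sum_contribution N)).pow_const n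
  have hgm : Measurable g := by fun_prop
  have hint : Integrable (fun ω => f (past X S (-1) ω) * g (S (-1) ω)) Pr := by
    refine Integrable.of_bound ((hfm.comp (henv.measurable_past (-1))).mul
      (hgm.comp (henv.measurable_sojourn (-1)))).aestronglyMeasurable ((|ρ| + C) ^ n) ?_
    filter_upwards [henv.ae_sojourn_pos hν] with ω hω
    rw [norm_mul, Real.norm_eq_abs, Real.norm_eq_abs, hf, hg, abs_pow, Real.abs_exp]
    have h1 := pow_le_pow_left₀ (abs_nonneg _) (abs_sub_sum_contribution_le hlam hβ hμ hC0 hC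
      (y := past X S (-1) ω) (fun j => hω _) ρ N) n
    have h2 : Real.exp (-(n * (μ * β l) * S (-1) ω)) ≤ 1 := by
      rw [Real.exp_le_one_iff, neg_nonpos]
      exact mul_nonneg (mul_nonneg n.cast_nonneg (mul_nonneg hμ.le (hβ l))) (hω (-1)).le
    calc _ ≤ (|ρ| + C) ^ n * 1 := mul_le_mul h1 h2 (Real.exp_nonneg _) (by positivity)
      _ = _ := mul_one _
  have hset : MeasurableSet {ω | X (-1) ω = l} :=
    henv.measurable_state (-1) (measurableSet_singleton l)
  have hL : ∫ ω in {ω | X (-1) ω = l}, (ρ -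
        ∑ j ∈ Finset.range (N + 1), contribution lam β μ (past X S 0 ω) j) ^ n ∂Pr =
      ∫ ω in {ω | X (-1) ω = l}, f (past X S (-1) ω) * g (S (-1) ω) ∂Pr := by
    refine setIntegral_congr_fun hset fun ω hω => ?_
    have hω' : X (-1) ω = l := hω
    have h0 : past X S 0 ω 0 = (l, S (-1) ω) := by simp [past, hω']
    have hp := past_succ (X := X) (S := S) 0 ω
    rw [zero_sub] at hp
    have e : g (S (-1) ω) = Real.exp (-(μ * β l * S (-1) ω)) ^ n := by
      rw [← Real.exp_nat_mul]
      simp only [hg]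
      congr 1
      ring
    rw [sum_contribution_succ, hp, h0, e, hf, ← mul_pow, ← hρ]
    congr 1
    ring
  rw [hL, henv.setIntegral_past_mul hP (-1) l hfm hgm hint]
  congr 1
  refine Finset.sum_congr rfl fun k _ => ?_
  rw [henv.setIntegral_past_shift (-1) 0 k hfm, zero_sub]

theorem IsPalmEnvironment.ae_presentMeasure_le (henv : IsPalmEnvironment P π ν Pr X S)
    [IsProbabilityMeasure Pr] (hν : ∀ k, ν k (Set.Iic 0) = 0) (hlam : ∀ k, 0 ≤ lam k)
    (hβ : ∀ k, 0 ≤ β k) (hμ : 0 < μ) (h0 : ∀ k, β k = 0 → lam k = 0) {C : ℝ} (hC0 : 0 ≤ C)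
    (hC : ∀ k, lam k / (μ * β k) ≤ C) :
    ∀ᵐ ω ∂Pr, (presentMeasure lam β μ X S ω).toReal ≤ C := by
  filter_upwards [henv.ae_presentMeasure hν hlam hβ hμ h0 hC0 hC, henv.ae_sojourn_pos hν]
    with ω h1 h2
  exact le_of_tendsto' h1.2 fun N => sum_contribution_le hβ hμ hC0 hC N fun j => h2 _

theorem IsPalmEnvironment.aestronglyMeasurable_presentMeasure
    (henv : IsPalmEnvironment P π ν Pr X S)
    [IsProbabilityMeasure Pr] (hν : ∀ k, ν k (Set.Iic 0) = 0) (hlam : ∀ k, 0 ≤ lam k)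
    (hβ : ∀ k, 0 ≤ β k) (hμ : 0 < μ) (h0 : ∀ k, β k = 0 → lam k = 0) {C : ℝ} (hC0 : 0 ≤ C)
    (hC : ∀ k, lam k / (μ * β k) ≤ C) :
    AEStronglyMeasurable (fun ω => (presentMeasure lam β μ X S ω).toReal) Pr :=
  aestronglyMeasurable_of_tendsto_ae Filter.atTop
    (fun N => ((measurable_sum_contribution N).comp (henv.measurable_past 0)).aestronglyMeasurable)
    ((henv.ae_presentMeasure hν hlam hβ hμ h0 hC0 hC).mono fun _ h => h.2)

theorem IsPalmEnvironment.setIntegral_pow_presentMeasure (henv : IsPalmEnvironment P π ν Pr X S)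
    [IsProbabilityMeasure Pr] [∀ k, IsProbabilityMeasure (ν k)] (hP : ∀ i j, 0 ≤ P i j)
    (hν : ∀ k, ν k (Set.Iic 0) = 0) (hlam : ∀ k, 0 ≤ lam k)
    (hβ : ∀ k, 0 ≤ β k) (hμ : 0 < μ) (h0 : ∀ k, β k = 0 → lam k = 0) {C : ℝ} (hC0 : 0 ≤ C)
    (hC : ∀ k, lam k / (μ * β k) ≤ C) (n : ℕ) (l : Fin K) :
    ∫ ω in {ω | X (-1) ω = l}, (lam l / (μ * β l) -
        (presentMeasure lam β μ X S ω).toReal) ^ n ∂Pr =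
      (∑ k, P k l * ∫ ω in {ω | X (-1) ω = k}, (lam l / (μ * β l) -
        (presentMeasure lam β μ X S ω).toReal) ^ n ∂Pr) *
          laplaceTransform (ν l) (n * (μ * β l)) := by
  have hlim : ∀ k, Filter.Tendsto (fun N => ∫ ω in {ω | X (-1) ω = k}, (lam l / (μ * β l) -
        ∑ j ∈ Finset.range N, contribution lam β μ (past X S 0 ω) j) ^ n ∂Pr) Filter.atTop
      (nhds (∫ ω in {ω | X (-1) ω = k}, (lam l / (μ * β l) -
        (presentMeasure lam β μ X S ω).toReal) ^ n ∂Pr)) := by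
    intro k
    refine tendsto_integral_of_dominated_convergence
      (fun _ => (|lam l / (μ * β l)| + C) ^ n) (fun N => ?_) (integrable_const _)
      (fun N => ae_restrict_of_ae ?_) (ae_restrict_of_ae ?_)
    · exact ((measurable_const.sub ((measurable_sum_contribution N).comp
        (henv.measurable_past 0))).pow_const n).aestronglyMeasurable
    · filter_upwards [henv.ae_sojourn_pos hν] with ω hω
      rw [Real.norm_eq_abs, abs_pow]
      exact pow_le_pow_left₀ (abs_nonneg _) (abs_sub_sum_contribution_le hlam hβ hμ hC0 hC
        (fun j => hω _) _ N) n
    · filter_upwards [henv.ae_presentMeasure hν hlam hβ hμ h0 hC0 hC] with ω hω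
      exact (hω.2.const_sub _).pow n
  -- The two sides involve `N + 1` and `N` terms; both index sequences lead to the same limit `|A|`.
  refine tendsto_nhds_unique ((hlim l).comp (Filter.tendsto_add_atTop_nat 1)) ?_
  refine ((tendsto_finsetSum _ fun k _ => (hlim k).const_mul (P k l)).mul_const
    (laplaceTransform (ν l) (n * (μ * β l)))).congr fun N => ?_
  exact (henv.setIntegral_pow_sum_succ hP hν hlam hβ hμ hC0 hC n N l).symm

/-- A general `Q ≪ Pr` covers both the conditional laws and the restrictions of `Pr`. -/
theorem IsPalmEnvironment.integrable_pow_presentMeasure (henv : IsPalmEnvironment P π ν Pr X S)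
    [IsProbabilityMeasure Pr] (hν : ∀ k, ν k (Set.Iic 0) = 0) (hlam : ∀ k, 0 ≤ lam k)
    (hβ : ∀ k, 0 ≤ β k) (hμ : 0 < μ) (h0 : ∀ k, β k = 0 → lam k = 0) {C : ℝ} (hC0 : 0 ≤ C)
    (hC : ∀ k, lam k / (μ * β k) ≤ C) (n : ℕ) {Q : Measure Ω} [IsFiniteMeasure Q]
    (hQ : Q ≪ Pr) :
    Integrable (fun ω => (presentMeasure lam β μ X S ω).toReal ^ n) Q := by
  refine Integrable.of_bound (((henv.aestronglyMeasurable_presentMeasure hν hlam hβ hμ h0 hC0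
    hC).pow n).mono_ac hQ) (C ^ n) (hQ.ae_le ?_)
  filter_upwards [henv.ae_presentMeasure_le hν hlam hβ hμ h0 hC0 hC] with ω hω
  rw [Real.norm_eq_abs, abs_pow, abs_of_nonneg ENNReal.toReal_nonneg]
  exact pow_le_pow_left₀ ENNReal.toReal_nonneg hω n

/-- The factor `π k` is the probability of the conditioning event, so it undoes the normalisation;
for `π k = 0` both sides vanish. -/
theorem IsPalmEnvironment.momentVec_mul (henv : IsPalmEnvironment P π ν Pr X S)
    [∀ k, IsProbabilityMeasure (ν k)] (hπ : ∀ k, 0 ≤ π k) (n : ℕ) (k : Fin K) :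
    momentVec lam β μ Pr X S n k * π k =
      ∫ ω in {ω | X (-1) ω = k}, (presentMeasure lam β μ X S ω).toReal ^ n ∂Pr := by
  rw [momentVec, lastStateCond, ProbabilityTheory.cond, integral_smul_measure,
    henv.measure_state, smul_eq_mul, ENNReal.toReal_inv, ENNReal.toReal_ofReal (hπ k)]
  rcases eq_or_ne (π k) 0 with h | h
  · have : Pr.restrict {ω | X (-1) ω = k} = 0 := by
      rw [Measure.restrict_eq_zero, henv.measure_state, h, ENNReal.ofReal_zero]
    simp [h, this]
  · field_simp

/-- The constant `c` is independent of `k` because the recursion for column `l` needs `c = ρ_l` on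
every event `{X (-1) = k}`. -/
theorem IsPalmEnvironment.sum_momentVec (henv : IsPalmEnvironment P π ν Pr X S)
    [IsProbabilityMeasure Pr] [∀ k, IsProbabilityMeasure (ν k)] (hπ : ∀ k, 0 ≤ π k)
    (hν : ∀ k, ν k (Set.Iic 0) = 0) (hlam : ∀ k, 0 ≤ lam k)
    (hβ : ∀ k, 0 ≤ β k) (hμ : 0 < μ) (h0 : ∀ k, β k = 0 → lam k = 0) {C : ℝ} (hC0 : 0 ≤ C)
    (hC : ∀ k, lam k / (μ * β k) ≤ C) (n : ℕ) (k : Fin K) (c : ℝ) :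
    ∑ j ∈ Finset.range (n + 1), (-1 : ℝ) ^ j * (n.choose j : ℝ) *
      (momentVec lam β μ Pr X S j k * π k * c ^ (n - j)) =
      ∫ ω in {ω | X (-1) ω = k}, (c - (presentMeasure lam β μ X S ω).toReal) ^ n ∂Pr := by
  have hpow : ∀ z : ℝ, (c - z) ^ n = ∑ j ∈ Finset.range (n + 1),
      (-1 : ℝ) ^ j * (n.choose j : ℝ) * c ^ (n - j) * z ^ j := by
    intro z
    rw [sub_eq_neg_add, add_pow]
    refine Finset.sum_congr rfl fun j _ => ?_
    rw [neg_pow z]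
    ring
  simp only [hpow]
  rw [integral_finsetSum]
  · refine Finset.sum_congr rfl fun j _ => ?_
    rw [integral_const_mul, henv.momentVec_mul hπ]
    ring
  · intro j _
    exact (henv.integrable_pow_presentMeasure hν hlam hβ hμ h0 hC0 hC j
      Measure.absolutelyContinuous_restrict).const_mul _

end Environment

end MMInfty

/-! ### Assembly of the matrix identity -/

theorem mainTheorem4 {K : ℕ}
    -- the routing matrix and its stationary law
    (P : Matrix (Fin K) (Fin K) ℝ) (hP : P ∈ Matrix.rowStochastic ℝ (Fin K))
    (hirr : P.IsIrreducible)
    (π : Fin K → ℝ) (hπ : MMInfty.IsStationaryLaw P π)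
    -- the laws of the positive sojourn times
    (ν : Fin K → Measure ℝ) [∀ k, IsProbabilityMeasure (ν k)] (hν : ∀ k, ν k (Set.Iic 0) = 0)
    -- arrival rates, server speeds and service rate
    (lam β : Fin K → ℝ) (μ : ℝ) (hlam : ∀ k, 0 ≤ lam k) (hβ : ∀ k, 0 ≤ β k)
    (hβpos : ∃ k, 0 < β k) (hμ : 0 < μ)
    -- the Palm version of the environment
    {Ω : Type*} [MeasurableSpace Ω] (Pr : Measure Ω) [IsProbabilityMeasure Pr]
    (X : ℤ → Ω → Fin K) (S : ℤ → Ω → ℝ) (henv : MMInfty.IsPalmEnvironment P π ν Pr X S) :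
    (∀ n : ℕ, 0 < n → IsUnit (MMInfty.matB' P ν β μ n)) ∧
    ((∀ k, β k = 0 → lam k = 0) →
      (∀ᵐ ω ∂Pr, MMInfty.presentMeasure lam β μ X S ω < ∞) ∧
      (∀ (n : ℕ) (k : Fin K),
        Integrable (fun ω => (MMInfty.presentMeasure lam β μ X S ω).toReal ^ n)
          (MMInfty.lastStateCond Pr X k)) ∧
      ∀ n : ℕ,
        ∑ j ∈ Finset.range (n + 1), ((-1 : ℝ) ^ j * (n.choose j : ℝ)) •
          (MMInfty.momentVec lam β μ Pr X S j ᵥ*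
            (Matrix.diagonal π * MMInfty.matB' P ν β μ n * MMInfty.matR lam β μ ^ (n - j))) = 0)
    := by
  have hP0 : ∀ i j, 0 ≤ P i j := hirr.nonneg
  refine ⟨fun n hn => MMInfty.isUnit_matB' hP hirr hν hβ hβpos hμ hn, fun h0 => ?_⟩
  obtain ⟨C, hC⟩ := (Set.finite_range fun k => lam k / (μ * β k)).bddAbove
  have hC' : ∀ k, lam k / (μ * β k) ≤ max C 0 := fun k => (hC ⟨k, rfl⟩).trans (le_max_left _ _)
  have hC0 : 0 ≤ max C 0 := le_max_right _ _
  refine ⟨(henv.ae_presentMeasure hν hlam hβ hμ h0 hC0 hC').mono fun _ h => h.1,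
    fun n k => ?_, fun n => ?_⟩
  · have : IsFiniteMeasure (MMInfty.lastStateCond Pr X k) := by
      unfold MMInfty.lastStateCond
      infer_instance
    exact henv.integrable_pow_presentMeasure hν hlam hβ hμ h0 hC0 hC' n
      ProbabilityTheory.cond_absolutelyContinuous
  -- The identity is checked column by column: the diagonal matrix `R^(n-j)` acts on the right, so
  -- column `l` involves the single ratio `c = ρ_l`.
  · funext l
    set c := lam l / (μ * β l) with hc
    set τ := MMInfty.laplaceTransform (ν l) (n * (μ * β l)) with hτ
    have hτpos : 0 < τ := MMInfty.laplaceTransform_pos (hν l)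
      (mul_nonneg n.cast_nonneg (mul_nonneg hμ.le (hβ l)))
    have hentry : ∀ j, (MMInfty.momentVec lam β μ Pr X S j ᵥ*
        (Matrix.diagonal π * MMInfty.matB' P ν β μ n * MMInfty.matR lam β μ ^ (n - j))) l =
        MMInfty.momentVec lam β μ Pr X S j l * π l * c ^ (n - j) * τ⁻¹ -
          ∑ k, MMInfty.momentVec lam β μ Pr X S j k * π k * c ^ (n - j) * P k l := by
      intro j
      rw [MMInfty.matR, Matrix.diagonal_pow, ← Matrix.vecMul_vecMul, Matrix.vecMul_diagonal,
        ← Matrix.vecMul_vecMul, MMInfty.matB', Matrix.vecMul_sub, Pi.sub_apply,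
        Matrix.vecMul_diagonal, Matrix.vecMul_diagonal, Pi.pow_apply, sub_mul]
      congr 1
      · ring
      · rw [Matrix.vecMul, dotProduct, Finset.sum_mul]
        refine Finset.sum_congr rfl fun k _ => ?_
        rw [Matrix.vecMul_diagonal]
        ring
    have hsum := fun k => henv.sum_momentVec hπ.nonneg hν hlam hβ hμ h0 hC0 hC' n k c
    have hrec := henv.setIntegral_pow_presentMeasure hP0 hν hlam hβ hμ h0 hC0 hC' n l
    rw [← hc, ← hτ] at hrec
    simp only [Finset.sum_apply, Pi.smul_apply, smul_eq_mul, Pi.zero_apply, hentry, mul_sub]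
    rw [Finset.sum_sub_distrib]
    have e1 : ∑ j ∈ Finset.range (n + 1), (-1 : ℝ) ^ j * (n.choose j : ℝ) *
        (MMInfty.momentVec lam β μ Pr X S j l * π l * c ^ (n - j) * τ⁻¹) =
        (∫ ω in {ω | X (-1) ω = l},
          (c - (MMInfty.presentMeasure lam β μ X S ω).toReal) ^ n ∂Pr) * τ⁻¹ := by
      rw [← hsum, Finset.sum_mul]
      exact Finset.sum_congr rfl fun j _ => by ring
    have e2 : ∑ j ∈ Finset.range (n + 1), (-1 : ℝ) ^ j * (n.choose j : ℝ) *
        (∑ k, MMInfty.momentVec lam β μ Pr X S j k * π k * c ^ (n - j) * P k l) =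
        ∑ k, P k l * ∫ ω in {ω | X (-1) ω = k},
          (c - (MMInfty.presentMeasure lam β μ X S ω).toReal) ^ n ∂Pr := by
      simp only [Finset.mul_sum, ← hsum]
      rw [Finset.sum_comm]
      exact Finset.sum_congr rfl fun k _ => Finset.sum_congr rfl fun j _ => by ring
    rw [e1, e2, hrec, mul_assoc, mul_inv_cancel₀ hτpos.ne', mul_one, sub_self]
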